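/- Let $a_1,a_2>0$ and $\delta_1,\delta_2$ be real numbers, and let $q$ be a real-valued function, continuous on $[-1,0)\cup(0,1]$, with finite one-sided limits $q(0\pm)$. For $\lambda\in\mathbb C$ consider the equation $$(a(x)u'')''+q(x)u=\lambda u,\qquad a(x)=a_1^4 \text{ on } [-1,0),\quad a(x)=a_2^4 \text{ on } (0,1].$$ For $i=1,2$ let $\chi_{i2}(x,\lambda)$ be the solution on $(0,1]$ and $\chi_{i1}(x,\lambda)$ the solution on $[-1,0)$ (both extended to $x=0$ together with their derivatives by one-sided limits; primes and $\frac{d^k}{dx^k}$ denote derivatives in $x$, one-sided at end points) determined by $$\chi_{12}(1)=-1,\quad \chi_{12}'(1)=\chi_{12}''(1)=0,\quad \chi_{12}'''(1)=\lambda,$$ $$\chi_{22}(1)=0,\quad \chi_{22}'(1)=-1,\quad \chi_{22}''(1)=\lambda,\quad \chi_{22}'''(1)=0,$$ $$\chi_{i1}(0)=\chi_{i2}(0),\quad \chi_{i1}'(0)=\chi_{i2}'(0),\quad \chi_{i1}''(0)=\chi_{i2}''(0)+\lambda\delta_1\chi_{i2}'(0),\quad \chi_{i1}'''(0)=\chi_{i2}'''(0)+\lambda\delta_2\chi_{i2}(0).$$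 Let $\lambda=s^4$, $s\in\mathbb C$. Then for $k=0,1,2,3$, as $|s|\to\infty$, $$\begin{aligned} \frac{d^k}{dx^k}\chi_{11}(x,\lambda)={}&-\frac{a_1^2s^2\delta_1\chi_{12}'(0)}{2}\frac{d^k}{dx^k}\cos\frac{sx}{a_1}-\frac{a_1^3s\delta_2\chi_{12}(0)}{2}\frac{d^k}{dx^k}\sin\frac{sx}{a_1}\\ &+\frac{a_1^2s^2\delta_1\chi_{12}'(0)}{4}\frac{d^k}{dx^k}\left(e^{\frac{sx}{a_1}}+e^{-\frac{sx}{a_1}}\right)+\frac{a_1^3s\delta_2\chi_{12}(0)}{4}\frac{d^k}{dx^k}\left(e^{\frac{sx}{a_1}}-e^{-\frac{sx}{a_1}}\right)\\ &+O\left(|s|^{k+1}e^{|s|\frac{a_1-a_2x}{a_1a_2}}\right),\\ \frac{d^k}{dx^k}\chi_{12}(x,\lambda)={}&-\frac{a_2^3s}{2}\frac{d^k}{dx^k}\sin\frac{s(x-1)}{a_2}+\frac{a_2^3s}{4}\frac{d^k}{dx^k}\left(e^{\frac{s(x-1)}{a_2}}-e^{-\frac{s(x-1)}{a_2}}\right)+O\left(|s|^{k+1}e^{|s|\frac{1-x}{a_2}}\right),\\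 \frac{d^k}{dx^k}\chi_{21}(x,\lambda)={}&-\frac{a_1^2s^2\delta_1\chi_{22}'(0)}{2}\frac{d^k}{dx^k}\cos\frac{sx}{a_1}-\frac{a_1^3s\delta_2\chi_{22}(0)}{2}\frac{d^k}{dx^k}\sin\frac{sx}{a_1}\\ &+\frac{a_1^2s^2\delta_1\chi_{22}'(0)}{4}\frac{d^k}{dx^k}\left(e^{\frac{sx}{a_1}}+e^{-\frac{sx}{a_1}}\right)+\frac{a_1^3s\delta_2\chi_{22}(0)}{4}\frac{d^k}{dx^k}\left(e^{\frac{sx}{a_1}}-e^{-\frac{sx}{a_1}}\right)\\ &+O\left(|s|^{k+2}e^{|s|\frac{a_1-a_2x}{a_1a_2}}\right),\\ \frac{d^k}{dx^k}\chi_{22}(x,\lambda)={}&-\frac{a_2^2s^2}{2}\frac{d^k}{dx^k}\cos\frac{s(x-1)}{a_2}+\frac{a_2^2s^2}{4}\frac{d^k}{dx^k}\left(e^{\frac{s(x-1)}{a_2}}+e^{-\frac{s(x-1)}{a_2}}\right)+O\left(|s|^{k+1}e^{|s|\frac{1-x}{a_2}}\right). \end{aligned}$$ Each formula holds uniformly in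 $x$ (in $[-1,0]$ for $\chi_{11},\chi_{21}$ and in $[0,1]$ for $\chi_{12},\chi_{22}$), with constants depending only on $a_1,a_2,\delta_1,\delta_2,q$. -/

import Mathlib

open Set Filter Topology

noncomputable section

/-- `k`-th derivative on the left interval `[-1, 0]` (one-sided at the end points). -/
def dLeft (k : ℕ) (u : ℝ → ℂ) (x : ℝ) : ℂ := iteratedDerivWithin k u (Icc (-1) 0) x

/-- `k`-th derivative on the right interval `[0, 1]` (one-sided at the end points). -/
def dRight (k : ℕ) (u : ℝ → ℂ) (x : ℝ) : ℂ := iteratedDerivWithin k u (Icc 0 1) x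

/-- `u` solves `(a u'')'' + q u = lam u` on `[-1, 0)`, where `a` is the constant `a₁ ^ 4`.
Since `q` has a finite limit at `0-`, a solution on `[-1, 0)` extends to a `C^4` function on
`[-1, 0]`; this extension gives the meaning of the values of `u` and its derivatives at `0`. -/
structure IsLeftSolution (a₁ : ℝ) (q : ℝ → ℝ) (lam : ℂ) (u : ℝ → ℂ) : Prop where
  contDiffOn : ContDiffOn ℝ 4 u (Icc (-1) 0)
  equation : ∀ x ∈ Ico (-1 : ℝ) 0,
    dLeft 2 (fun y => (a₁ : ℂ) ^ 4 * dLeft 2 u y) x + (q x : ℂ) * u x = lam * u x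

/-- `u` solves `(a u'')'' + q u = lam u` on `(0, 1]`, where `a` is the constant `a₂ ^ 4`,
and is understood to be extended to a `C^4` function on `[0, 1]`. -/
structure IsRightSolution (a₂ : ℝ) (q : ℝ → ℝ) (lam : ℂ) (u : ℝ → ℂ) : Prop where
  contDiffOn : ContDiffOn ℝ 4 u (Icc 0 1)
  equation : ∀ x ∈ Ioc (0 : ℝ) 1,
    dRight 2 (fun y => (a₂ : ℂ) ^ 4 * dRight 2 u y) x + (q x : ℂ) * u x = lam * u x

/-- `v` is the solution on `(0, 1]` with `v^(j)(1) = c j` for `j = 0, 1, 2, 3`. -/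
structure IsRightCauchySolution (a₂ : ℝ) (q : ℝ → ℝ) (lam : ℂ) (c : Fin 4 → ℂ)
    (v : ℝ → ℂ) : Prop where
  solution : IsRightSolution a₂ q lam v
  initial : ∀ j : Fin 4, dRight j v 1 = c j

/-- `u` is the solution on `[-1, 0)` that is obtained from the solution `v` on `(0, 1]` through the
transmission conditions at `0`. -/
structure IsLeftTransmitted (a₁ δ₁ δ₂ : ℝ) (q : ℝ → ℝ) (lam : ℂ) (u v : ℝ → ℂ) : Prop where
  solution : IsLeftSolution a₁ q lam u
  trans_zero : dLeft 0 u 0 = dRight 0 v 0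
  trans_one : dLeft 1 u 0 = dRight 1 v 0
  trans_two : dLeft 2 u 0 = dRight 2 v 0 + lam * δ₁ * dRight 1 v 0
  trans_three : dLeft 3 u 0 = dRight 3 v 0 + lam * δ₂ * dRight 0 v 0

/-- The pair `χ₁₁` (on `[-1, 0)`) and `χ₁₂` (on `(0, 1]`) for the spectral parameter `lam`. -/
structure IsChiOne (a₁ a₂ δ₁ δ₂ : ℝ) (q : ℝ → ℝ) (lam : ℂ) (χ₁₁ χ₁₂ : ℝ → ℂ) : Prop where
  right : IsRightCauchySolution a₂ q lam ![-1, 0, 0, lam] χ₁₂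
  left : IsLeftTransmitted a₁ δ₁ δ₂ q lam χ₁₁ χ₁₂

/-- The pair `χ₂₁` (on `[-1, 0)`) and `χ₂₂` (on `(0, 1]`) for the spectral parameter `lam`. -/
structure IsChiTwo (a₁ a₂ δ₁ δ₂ : ℝ) (q : ℝ → ℝ) (lam : ℂ) (χ₂₁ χ₂₂ : ℝ → ℂ) : Prop where
  right : IsRightCauchySolution a₂ q lam ![0, -1, lam, 0] χ₂₂
  left : IsLeftTransmitted a₁ δ₁ δ₂ q lam χ₂₁ χ₂₂

/-- The leading terms on `[-1, 0]`, written with the values `v0 = v(0)` and `v1 = v'(0)` of the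
solution `v` on the right interval. -/
def leftLeading (a₁ δ₁ δ₂ : ℝ) (s v0 v1 : ℂ) (k : ℕ) (x : ℝ) : ℂ :=
  -((a₁ : ℂ) ^ 2 * s ^ 2 * δ₁ * v1 / 2)
      * iteratedDeriv k (fun y : ℝ => Complex.cos (s * y / a₁)) x
    - (a₁ : ℂ) ^ 3 * s * δ₂ * v0 / 2
      * iteratedDeriv k (fun y : ℝ => Complex.sin (s * y / a₁)) x
    + (a₁ : ℂ) ^ 2 * s ^ 2 * δ₁ * v1 / 4
      * iteratedDeriv k
          (fun y : ℝ => Complex.exp (s * y / a₁) + Complex.exp (-(s * y / a₁))) x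
    + (a₁ : ℂ) ^ 3 * s * δ₂ * v0 / 4
      * iteratedDeriv k
          (fun y : ℝ => Complex.exp (s * y / a₁) - Complex.exp (-(s * y / a₁))) x

/-- The leading terms of `χ₁₂` on `[0, 1]`. -/
def chi12Leading (a₂ : ℝ) (s : ℂ) (k : ℕ) (x : ℝ) : ℂ :=
  -((a₂ : ℂ) ^ 3 * s / 2)
      * iteratedDeriv k (fun y : ℝ => Complex.sin (s * (y - 1) / a₂)) x
    + (a₂ : ℂ) ^ 3 * s / 4
      * iteratedDeriv k
          (fun y : ℝ => Complex.exp (s * (y - 1) / a₂) - Complex.exp (-(s * (y - 1) / a₂))) x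

/-- The leading terms of `χ₂₂` on `[0, 1]`. -/
def chi22Leading (a₂ : ℝ) (s : ℂ) (k : ℕ) (x : ℝ) : ℂ :=
  -((a₂ : ℂ) ^ 2 * s ^ 2 / 2)
      * iteratedDeriv k (fun y : ℝ => Complex.cos (s * (y - 1) / a₂)) x
    + (a₂ : ℂ) ^ 2 * s ^ 2 / 4
      * iteratedDeriv k
          (fun y : ℝ => Complex.exp (s * (y - 1) / a₂) + Complex.exp (-(s * (y - 1) / a₂))) x

end

/-! Write `μ = s / a` on an interval where `a` is constant. The equation says that `u'''' - μ ^ 4 *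
u` equals `-q * u / a ^ 4`, which is bounded by a constant times `‖u‖`. For each fourth root `c = I
^ n * μ` of `μ ^ 4`, the mode `c ^ 3 * u + c ^ 2 * u' + c * u'' + u'''` satisfies a scalar equation
`W' = c * W + r` whose forcing `r` is that small term, and all four `c` have modulus `‖μ‖`. The
derivatives of `u` are recovered from the modes by an inverse discrete Fourier transform, at the
cost of a factor `‖μ‖ ^ (k - 3)`.

Gronwall on the four modes bounds `u` by its end point data times `exp (‖μ‖ * t)` (`chain_growth`).
Feeding this into the forcing for `u - L`, where `L` solves the equation with `q = 0`, shows that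
the potential contributes only the data divided by `‖μ‖ ^ 3` (`chain_sub_growth`).

The leading terms in the theorem are the solutions `L` with data `0, 0, A * μ ^ 2, B * μ ^ 3` that
absorb exactly the entries carrying `λ`: the initial value `λ` at `1`, and the jumps `λ * δ₁ *
v'(0)`, `λ * δ₂ * v(0)` at `0`. What remains is the discrepancy in the data. On the left the jumps
enlarge the weighted data by `‖s‖ ^ 3`, which the gain from the potential cancels. -/

/-! ### Modes of a chain of derivatives -/

/-- The mode `∑ j, c ^ (3 - j) * u j` of a chain `u 0, u 1, u 2, u 3` of successive derivatives. -/
def chainMode (c : ℂ) (u : ℕ → ℝ → ℂ) (t : ℝ) : ℂ :=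
  c ^ 3 * u 0 t + c ^ 2 * u 1 t + c * u 2 t + u 3 t

/-- Differentiation shifts the sum, so it becomes `c` times itself except at the ends, where `u 4`
appears in place of `c ^ 4 * u 0`. All four roots of `μ ^ 4` thus give decoupled scalar equations
with the same forcing. -/
theorem hasDerivWithinAt_chainMode {c μ : ℂ} (hc : c ^ 4 = μ ^ 4) {u : ℕ → ℝ → ℂ} {S : Set ℝ}
    {t : ℝ} (hu : ∀ j ≤ 3, HasDerivWithinAt (u j) (u (j + 1) t) S t) :
    HasDerivWithinAt (chainMode c u) (c * chainMode c u t + (u 4 t - μ ^ 4 * u 0 t)) S t := by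
  have h := ((((hu 0 (by norm_num)).const_mul (c ^ 3)).add
    ((hu 1 (by norm_num)).const_mul (c ^ 2))).add ((hu 2 (by norm_num)).const_mul c)).add
    (hu 3 (by norm_num))
  refine (h.congr_deriv ?_).congr_of_eventuallyEq (Eventually.of_forall fun _ => rfl) rfl
  simp only [chainMode]
  rw [← hc]
  ring

/-- Variation of constants without an integral: the mean value inequality is applied to `τ ↦ exp (c
* (t - τ)) * W τ`. The kernel and the bound on `r` multiply to `ρ * exp (m * t)` for every `τ`, so
the exponential rate stays `m`. -/
theorem norm_le_of_norm_hasDerivWithinAt_sub_le {W r : ℝ → ℂ} {c : ℂ} {m ρ : ℝ}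
    (hc : ‖c‖ ≤ m) (hρ : 0 ≤ ρ)
    (hW : ∀ t ∈ Icc (0 : ℝ) 1, HasDerivWithinAt W (c * W t + r t) (Icc 0 1) t)
    (hr : ∀ t ∈ Icc (0 : ℝ) 1, ‖r t‖ ≤ ρ * Real.exp (m * t)) {t : ℝ} (ht : t ∈ Icc (0 : ℝ) 1) :
    ‖W t‖ ≤ Real.exp (m * t) * (‖W 0‖ + ρ) := by
  have hexp : ∀ τ ∈ Icc 0 t, ‖Complex.exp (c * ((t - τ : ℝ) : ℂ))‖ ≤ Real.exp (m * (t - τ)) := by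
    intro τ hτ
    rw [Complex.norm_exp]
    refine Real.exp_le_exp.mpr ((Complex.re_le_norm _).trans ?_)
    rw [norm_mul, Complex.norm_real, Real.norm_of_nonneg (sub_nonneg.mpr hτ.2)]
    exact mul_le_mul_of_nonneg_right hc (sub_nonneg.mpr hτ.2)
  have hsub : Icc 0 t ⊆ Icc (0 : ℝ) 1 := Icc_subset_Icc_right ht.2
  have hder : ∀ τ ∈ Icc 0 t,
      HasDerivWithinAt (fun τ : ℝ => Complex.exp (c * ((t - τ : ℝ) : ℂ)) * W τ)
        (Complex.exp (c * ((t - τ : ℝ) : ℂ)) * r τ) (Icc 0 t) τ := by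
    intro τ hτ
    have h1 : HasDerivAt (fun τ : ℝ => ((t - τ : ℝ) : ℂ)) ((-1 : ℝ) : ℂ) τ :=
      ((hasDerivAt_id τ).const_sub t).ofReal_comp
    have h2 := ((h1.const_mul c).cexp).hasDerivWithinAt (s := Icc 0 t)
    refine (h2.mul ((hW τ (hsub hτ)).mono hsub)).congr_deriv ?_
    push_cast
    ring
  have hb : ∀ τ ∈ Icc 0 t,
      ‖Complex.exp (c * ((t - τ : ℝ) : ℂ)) * r τ‖ ≤ ρ * Real.exp (m * t) := by
    intro τ hτ
    rw [norm_mul]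
    calc _ ≤ Real.exp (m * (t - τ)) * (ρ * Real.exp (m * τ)) :=
          mul_le_mul (hexp τ hτ) (hr τ (hsub hτ)) (norm_nonneg _) (Real.exp_pos _).le
      _ = ρ * (Real.exp (m * (t - τ)) * Real.exp (m * τ)) := by ring
      _ = ρ * Real.exp (m * t) := by rw [← Real.exp_add]; ring_nf
  have h := (convex_Icc 0 t).norm_image_sub_le_of_norm_hasDerivWithin_le hder hb
    (left_mem_Icc.mpr ht.1) (right_mem_Icc.mpr ht.1)
  simp only [sub_self, sub_zero, Complex.ofReal_zero, mul_zero, Complex.exp_zero, one_mul] at h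
  rw [Real.norm_of_nonneg ht.1] at h
  have h0 := hexp 0 (left_mem_Icc.mpr ht.1)
  simp only [sub_zero] at h0
  have hE := Real.exp_pos (m * t)
  calc ‖W t‖ ≤ ‖W t - Complex.exp (c * (t : ℂ)) * W 0‖ + ‖Complex.exp (c * (t : ℂ)) * W 0‖ :=
        norm_le_norm_sub_add _ _
    _ ≤ ρ * Real.exp (m * t) * t + Real.exp (m * t) * ‖W 0‖ := by
        rw [norm_mul]
        exact add_le_add h (mul_le_mul_of_nonneg_right h0 (norm_nonneg _))
    _ ≤ ρ * Real.exp (m * t) * 1 + Real.exp (m * t) * ‖W 0‖ := by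
        gcongr
        exact ht.2
    _ = _ := by ring

theorem I_pow_mul_pow_four (n : ℕ) (μ : ℂ) : (Complex.I ^ n * μ) ^ 4 = μ ^ 4 := by
  rw [mul_pow, ← pow_mul, mul_comm n 4, pow_mul, Complex.I_pow_four, one_pow, one_mul]

theorem norm_I_pow_mul (n : ℕ) (μ : ℂ) : ‖Complex.I ^ n * μ‖ = ‖μ‖ := by
  simp

/-- Recovering the chain from its four modes. -/
theorem norm_mul_pow_le_of_chainMode_le {μ : ℂ} {u : ℕ → ℝ → ℂ} {t B : ℝ}
    (hB : ∀ n : ℕ, n < 4 → ‖chainMode (Complex.I ^ n * μ) u t‖ ≤ B) {k : ℕ} (hk : k ≤ 3) :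
    ‖u k t‖ * ‖μ‖ ^ 3 ≤ ‖μ‖ ^ k * B := by
  -- Inverse discrete Fourier transform: the sum over `n` of `I ^ (n * (k + 1)) * I ^ (n * (3 - j))`
  -- is `4` for `j = k` and `0` for the other `j ≤ 3`.
  have key : 4 * (u k t * μ ^ 3) =
      μ ^ k * (chainMode (Complex.I ^ 0 * μ) u t
        + Complex.I ^ (k + 1) * chainMode (Complex.I ^ 1 * μ) u t
        + (Complex.I ^ 2) ^ (k + 1) * chainMode (Complex.I ^ 2 * μ) u t
        + (Complex.I ^ 3) ^ (k + 1) * chainMode (Complex.I ^ 3 * μ) u t) := by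
    have h2 : Complex.I ^ 2 = -1 := Complex.I_sq
    have h3 : Complex.I ^ 3 = -Complex.I := Complex.I_pow_three
    rw [h2, h3]
    simp only [chainMode]
    interval_cases k <;> ring_nf <;> simp only [h2, Complex.I_pow_four,
      show Complex.I ^ 6 = -1 by rw [pow_add _ 4 2, Complex.I_pow_four, one_mul, h2]] <;>
      ring
  have hn : ∀ (z w : ℂ), ‖z‖ = 1 → ‖w‖ ≤ B → ‖z * w‖ ≤ B := fun z w hz hw => by
    rwa [norm_mul, hz, one_mul]
  have h := congrArg norm key
  rw [norm_mul, norm_mul, norm_mul, norm_pow, norm_pow] at h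
  have h4 : ‖(4 : ℂ)‖ = 4 := by norm_num
  rw [h4] at h
  have hs := norm_add₄_le (a := chainMode (Complex.I ^ 0 * μ) u t)
    (b := Complex.I ^ (k + 1) * chainMode (Complex.I ^ 1 * μ) u t)
    (c := (Complex.I ^ 2) ^ (k + 1) * chainMode (Complex.I ^ 2 * μ) u t)
    (d := (Complex.I ^ 3) ^ (k + 1) * chainMode (Complex.I ^ 3 * μ) u t)
  have e0 := hB 0 (by norm_num)
  have e1 := hn (Complex.I ^ (k + 1)) _ (by simp) (hB 1 (by norm_num))
  have e2 := hn ((Complex.I ^ 2) ^ (k + 1)) _ (by simp) (hB 2 (by norm_num))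
  have e3 := hn ((Complex.I ^ 3) ^ (k + 1)) _ (by simp) (hB 3 (by norm_num))
  have := mul_le_mul_of_nonneg_left (hs.trans (by linarith : _ ≤ 4 * B))
    (pow_nonneg (norm_nonneg μ) k)
  linarith

theorem norm_chainMode_le {c : ℂ} {u : ℕ → ℝ → ℂ} {t B : ℝ}
    (h : ∀ j ≤ 3, ‖u j t‖ * ‖c‖ ^ (3 - j) ≤ B) : ‖chainMode c u t‖ ≤ 4 * B := by
  have h0 := h 0 (by norm_num)
  have h1 := h 1 (by norm_num)
  have h2 := h 2 (by norm_num)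
  have h3 := h 3 (by norm_num)
  norm_num at h0 h1 h2 h3
  refine norm_add₄_le.trans ?_
  simp only [norm_mul, norm_pow]
  linarith

/-! ### Growth and perturbation estimates on the unit interval -/

section Estimates

variable {μ : ℂ} {G M D : ℝ} {u L : ℕ → ℝ → ℂ}

/-- Gronwall for the sup norm of the four modes: each rate is at most `‖μ‖`, and the forcing adds at
most `G`, since `‖u 0 t‖` is itself bounded by the modes when `1 ≤ ‖μ‖`. As `t ≤ 1`, the extra
growth `exp (G * t)` is absorbed in `exp G`. -/
theorem chain_growth (hμ : 1 ≤ ‖μ‖) (hG : 0 ≤ G)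
    (hu : ∀ j ≤ 3, ∀ t ∈ Icc (0 : ℝ) 1, HasDerivWithinAt (u j) (u (j + 1) t) (Icc 0 1) t)
    (heq : ∀ t ∈ Icc (0 : ℝ) 1, ‖u 4 t - μ ^ 4 * u 0 t‖ ≤ G * ‖u 0 t‖)
    (hM : ∀ j ≤ 3, ‖u j 0‖ * ‖μ‖ ^ (3 - j) ≤ M) {k : ℕ} (hk : k ≤ 3) {t : ℝ}
    (ht : t ∈ Icc (0 : ℝ) 1) :
    ‖u k t‖ * ‖μ‖ ^ 3 ≤ ‖μ‖ ^ k * (4 * M * Real.exp G * Real.exp (‖μ‖ * t)) := by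
  have hM0 : 0 ≤ M := le_trans (by positivity) (hM 0 (by norm_num))
  have hmode : ∀ n : ℕ, ∀ t ∈ Icc (0 : ℝ) 1,
      HasDerivWithinAt (chainMode (Complex.I ^ n * μ) u)
        (Complex.I ^ n * μ * chainMode (Complex.I ^ n * μ) u t + (u 4 t - μ ^ 4 * u 0 t))
        (Icc 0 1) t := fun n t ht =>
    hasDerivWithinAt_chainMode (I_pow_mul_pow_four n μ) fun j hj => hu j hj t ht
  let f : ℝ → Fin 4 → ℂ := fun t n => chainMode (Complex.I ^ (n : ℕ) * μ) u t
  let f' : ℝ → Fin 4 → ℂ := fun t n =>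
    Complex.I ^ (n : ℕ) * μ * chainMode (Complex.I ^ (n : ℕ) * μ) u t + (u 4 t - μ ^ 4 * u 0 t)
  have hf : ∀ t ∈ Icc (0 : ℝ) 1, HasDerivWithinAt f (f' t) (Icc 0 1) t := fun t ht =>
    hasDerivWithinAt_pi.mpr fun n => hmode n t ht
  have hfn : ∀ t, ∀ n : ℕ, n < 4 → ‖chainMode (Complex.I ^ n * μ) u t‖ ≤ ‖f t‖ :=
    fun t n hn => norm_le_pi_norm (f t) ⟨n, hn⟩
  have hu0 : ∀ t, ‖u 0 t‖ ≤ ‖f t‖ := by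
    intro t
    have h := norm_mul_pow_le_of_chainMode_le (k := 0) (hfn t) (by norm_num)
    rw [pow_zero, one_mul] at h
    exact (le_mul_of_one_le_right (norm_nonneg _) (one_le_pow₀ hμ)).trans h
  have hgr := norm_le_gronwallBound_of_norm_deriv_right_le (f := f) (f' := f')
    (δ := 4 * M) (K := ‖μ‖ + G) (ε := 0) (a := 0) (b := 1)
    (fun t ht => (hf t ht).continuousWithinAt)
    (fun t ht => (hf t (Ico_subset_Icc_self ht)).mono_of_mem_nhdsWithin
      (Icc_mem_nhdsGE_of_mem ht))
    ((pi_norm_le_iff_of_nonneg (by positivity)).mpr fun n =>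
      norm_chainMode_le fun j hj => by rw [norm_I_pow_mul]; exact hM j hj)
    (by
      intro t ht
      refine (pi_norm_le_iff_of_nonneg (by positivity)).mpr fun n => ?_
      refine (norm_add_le _ _).trans ?_
      rw [norm_mul, norm_I_pow_mul, add_zero, add_mul]
      exact add_le_add (mul_le_mul_of_nonneg_left (hfn t n n.2) (norm_nonneg _))
        ((heq t (Ico_subset_Icc_self ht)).trans (mul_le_mul_of_nonneg_left (hu0 t) hG)))
    t ht
  rw [gronwallBound_ε0, sub_zero] at hgr
  refine norm_mul_pow_le_of_chainMode_le (fun n hn => ((hfn t n hn).trans hgr).trans ?_) hk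
  rw [mul_assoc (4 * M), ← Real.exp_add]
  refine mul_le_mul_of_nonneg_left (Real.exp_le_exp.mpr ?_) (by positivity)
  nlinarith [ht.2]

/-- The modes of `u - L` have the forcing of `u` alone, and `chain_growth` with `k = 0` makes it of
order `M / ‖μ‖ ^ 3`. This is the gain that makes the potential a lower order effect. -/
theorem chain_sub_growth (hμ : 1 ≤ ‖μ‖) (hG : 0 ≤ G)
    (hu : ∀ j ≤ 3, ∀ t ∈ Icc (0 : ℝ) 1, HasDerivWithinAt (u j) (u (j + 1) t) (Icc 0 1) t)
    (heq : ∀ t ∈ Icc (0 : ℝ) 1, ‖u 4 t - μ ^ 4 * u 0 t‖ ≤ G * ‖u 0 t‖)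
    (hM : ∀ j ≤ 3, ‖u j 0‖ * ‖μ‖ ^ (3 - j) ≤ M)
    (hL : ∀ j ≤ 3, ∀ t ∈ Icc (0 : ℝ) 1, HasDerivWithinAt (L j) (L (j + 1) t) (Icc 0 1) t)
    (hL4 : ∀ t ∈ Icc (0 : ℝ) 1, L 4 t = μ ^ 4 * L 0 t)
    (hD : ∀ j ≤ 3, ‖u j 0 - L j 0‖ * ‖μ‖ ^ (3 - j) ≤ D) {k : ℕ} (hk : k ≤ 3) {t : ℝ}
    (ht : t ∈ Icc (0 : ℝ) 1) :
    ‖u k t - L k t‖ * ‖μ‖ ^ 3 ≤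
      ‖μ‖ ^ k * (Real.exp (‖μ‖ * t) * (4 * D + G * (4 * M * Real.exp G) / ‖μ‖ ^ 3)) := by
  have hM0 : 0 ≤ M := le_trans (by positivity) (hM 0 (by norm_num))
  have hm : 0 < ‖μ‖ ^ 3 := by positivity
  refine norm_mul_pow_le_of_chainMode_le (u := fun j => u j - L j) (fun n hn => ?_) hk
  have h0 : ‖chainMode (Complex.I ^ n * μ) (fun j => u j - L j) 0‖ ≤ 4 * D :=
    norm_chainMode_le fun j hj => by rw [norm_I_pow_mul]; exact hD j hj
  refine (norm_le_of_norm_hasDerivWithinAt_sub_le (m := ‖μ‖)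
    (ρ := G * (4 * M * Real.exp G) / ‖μ‖ ^ 3) (norm_I_pow_mul n μ).le (by positivity)
    (fun t ht => hasDerivWithinAt_chainMode (I_pow_mul_pow_four n μ) fun j hj =>
      (hu j hj t ht).sub (hL j hj t ht)) (fun t ht => ?_) ht).trans
    (mul_le_mul_of_nonneg_left (by linarith) (Real.exp_pos _).le)
  have hg := chain_growth hμ hG hu heq hM (k := 0) (by norm_num) ht
  rw [pow_zero, one_mul] at hg
  simp only [Pi.sub_apply]
  rw [hL4 t ht]
  calc ‖u 4 t - μ ^ 4 * L 0 t - μ ^ 4 * (u 0 t - L 0 t)‖ = ‖u 4 t - μ ^ 4 * u 0 t‖ := by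
        congr 1; ring
    _ ≤ G * ‖u 0 t‖ := heq t ht
    _ ≤ G * (4 * M * Real.exp G * Real.exp (‖μ‖ * t) / ‖μ‖ ^ 3) :=
        mul_le_mul_of_nonneg_left ((le_div_iff₀ hm).mpr hg) hG
    _ = _ := by ring

end Estimates

/-! ### Passage to data at the right end point -/

section Reflection

variable {α b : ℝ} {v : ℕ → ℝ → ℂ}

/-- The data sit at the right end, so the interval is run backwards; the signs `(-1) ^ j` keep the
chain a chain and disappear at the even orders `0` and `4` of the equation. -/
theorem hasDerivWithinAt_reflect (hα : α + 1 = b)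
    (hv : ∀ j ≤ 3, ∀ x ∈ Icc α b, HasDerivWithinAt (v j) (v (j + 1) x) (Icc α b) x)
    (j : ℕ) (hj : j ≤ 3) (t : ℝ) (ht : t ∈ Icc (0 : ℝ) 1) :
    HasDerivWithinAt (fun t => (-1) ^ j * v j (b - t)) ((-1) ^ (j + 1) * v (j + 1) (b - t))
      (Icc 0 1) t := by
  have hmaps : MapsTo (fun t : ℝ => b - t) (Icc 0 1) (Icc α b) := fun t ht =>
    ⟨by linarith [ht.2], by linarith [ht.1]⟩
  have h := (hv j hj _ (hmaps ht)).scomp t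
    ((hasDerivAt_id t).const_sub b).hasDerivWithinAt hmaps
  refine (h.const_mul ((-1 : ℂ) ^ j)).congr_deriv ?_
  simp [pow_succ]

/-- Growth of a chain of derivatives with `‖v 4 - (s / a) ^ 4 * v 0‖ ≤ G * ‖v 0‖`, and its distance
to a solution `L` of `L 4 = (s / a) ^ 4 * L 0`, in terms of the data at the right end point. -/
theorem exists_chain_estimate (a G : ℝ) (ha : 0 < a) (hG : 0 ≤ G) (hα : α + 1 = b) :
    ∃ C : ℝ, 0 ≤ C ∧ ∀ s : ℂ, 1 ≤ ‖s‖ → a ≤ ‖s‖ → ∀ (v L : ℕ → ℝ → ℂ) (M D : ℝ),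
      (∀ j ≤ 3, ∀ x ∈ Icc α b, HasDerivWithinAt (v j) (v (j + 1) x) (Icc α b) x) →
      (∀ x ∈ Icc α b, ‖v 4 x - (s / a) ^ 4 * v 0 x‖ ≤ G * ‖v 0 x‖) →
      (∀ j ≤ 3, ∀ x ∈ Icc α b, HasDerivWithinAt (L j) (L (j + 1) x) (Icc α b) x) →
      (∀ x ∈ Icc α b, L 4 x = (s / a) ^ 4 * L 0 x) →
      (∀ j ≤ 3, ‖v j b‖ * ‖s‖ ^ (3 - j) ≤ M) →
      (∀ j ≤ 3, ‖v j b - L j b‖ * ‖s‖ ^ (3 - j) ≤ D) →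
      ∀ k ≤ 3, ∀ x ∈ Icc α b,
        ‖v k x‖ * ‖s‖ ^ 3 ≤ C * ‖s‖ ^ k * M * Real.exp (‖s‖ * ((b - x) / a)) ∧
        ‖v k x - L k x‖ * ‖s‖ ^ 3 ≤
          C * ‖s‖ ^ k * (D + M / ‖s‖ ^ 3) * Real.exp (‖s‖ * ((b - x) / a)) := by
  obtain ⟨c, hc1, hca⟩ : ∃ c : ℝ, 1 ≤ c ∧ a⁻¹ ≤ c := ⟨max 1 a⁻¹, le_max_left _ _, le_max_right _ _⟩
  obtain ⟨e, he1, hea⟩ : ∃ e : ℝ, 1 ≤ e ∧ a ≤ e := ⟨max 1 a, le_max_left _ _, le_max_right _ _⟩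
  have hc0 : 0 ≤ c := by linarith
  have he0 : 0 ≤ e := by linarith
  -- Here `e ^ 3` trades `‖s‖ ^ 3` for `‖s / a‖ ^ 3`, one `c ^ 3` trades `‖s / a‖ ^ k` back, and the
  -- other converts the weights of the data. The last factor dominates `exp G`, `1` and `G * e ^ 3 *
  -- exp G` at once.
  refine ⟨4 * (e ^ 3 * c ^ 3 * c ^ 3) * (1 + (1 + G * e ^ 3) * Real.exp G), by positivity, ?_⟩
  intro s hs1 hsa v L M D hv heq hL hL4 hM hD k hk x hx
  have hS : 0 < ‖s‖ := by linarith
  have hm : ‖s / (a : ℂ)‖ = ‖s‖ / a := by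
    rw [norm_div, Complex.norm_real, Real.norm_of_nonneg ha.le]
  have hm1 : 1 ≤ ‖s / (a : ℂ)‖ := by rwa [hm, le_div_iff₀ ha, one_mul]
  have hM0 : 0 ≤ M := le_trans (by positivity) (hM 0 (by norm_num))
  have hD0 : 0 ≤ D := le_trans (by positivity) (hD 0 (by norm_num))
  have hpow : ∀ i ≤ 3, ‖s / (a : ℂ)‖ ^ i ≤ c ^ 3 * ‖s‖ ^ i := by
    intro i hi
    rw [hm, div_eq_inv_mul, mul_pow]
    refine mul_le_mul_of_nonneg_right ?_ (by positivity)
    exact (pow_le_pow_left₀ (by positivity) hca i).trans (pow_le_pow_right₀ hc1 hi)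
  have hsub : ∀ t ∈ Icc (0 : ℝ) 1, b - t ∈ Icc α b := fun t ht =>
    ⟨by linarith [ht.2], by linarith [ht.1]⟩
  have hneg : ∀ (j : ℕ) (z : ℂ), ‖(-1) ^ j * z‖ = ‖z‖ := fun j z => by simp
  have hnegs : ∀ (j : ℕ) (z w : ℂ), ‖(-1) ^ j * z - (-1) ^ j * w‖ = ‖z - w‖ := fun j z w => by
    rw [← mul_sub, hneg]
  have hdata : ∀ (z : ℂ) (B : ℝ) (j : ℕ), ‖z‖ * ‖s‖ ^ (3 - j) ≤ B →
      ‖z‖ * ‖s / (a : ℂ)‖ ^ (3 - j) ≤ c ^ 3 * B := by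
    intro z B j h
    calc _ ≤ ‖z‖ * (c ^ 3 * ‖s‖ ^ (3 - j)) :=
          mul_le_mul_of_nonneg_left (hpow _ (by omega)) (norm_nonneg _)
      _ = c ^ 3 * (‖z‖ * ‖s‖ ^ (3 - j)) := by ring
      _ ≤ _ := mul_le_mul_of_nonneg_left h (by positivity)
  have heq' : ∀ t ∈ Icc (0 : ℝ) 1,
      ‖(-1) ^ 4 * v 4 (b - t) - (s / (a : ℂ)) ^ 4 * ((-1) ^ 0 * v 0 (b - t))‖ ≤
        G * ‖(-1) ^ 0 * v 0 (b - t)‖ := by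
    intro t ht
    have := heq _ (hsub t ht)
    norm_num
    exact this
  have hL4' : ∀ t ∈ Icc (0 : ℝ) 1,
      (-1) ^ 4 * L 4 (b - t) = (s / (a : ℂ)) ^ 4 * ((-1) ^ 0 * L 0 (b - t)) := by
    intro t ht
    rw [hL4 _ (hsub t ht)]
    norm_num
  have hM' : ∀ j ≤ 3, ‖(-1) ^ j * v j (b - 0)‖ * ‖s / (a : ℂ)‖ ^ (3 - j) ≤ c ^ 3 * M := by
    intro j hj
    rw [hneg, sub_zero]
    exact hdata _ _ _ (hM j hj)
  have hD' : ∀ j ≤ 3, ‖(-1) ^ j * v j (b - 0) - (-1) ^ j * L j (b - 0)‖ *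
      ‖s / (a : ℂ)‖ ^ (3 - j) ≤ c ^ 3 * D := by
    intro j hj
    rw [hnegs, sub_zero]
    exact hdata _ _ _ (hD j hj)
  have ht : b - x ∈ Icc (0 : ℝ) 1 := ⟨by linarith [hx.2], by linarith [hx.1]⟩
  have g1 := chain_growth (u := fun j t => (-1) ^ j * v j (b - t)) hm1 hG
    (hasDerivWithinAt_reflect hα hv) heq' hM' hk ht
  have g2 := chain_sub_growth (u := fun j t => (-1) ^ j * v j (b - t))
    (L := fun j t => (-1) ^ j * L j (b - t)) hm1 hG
    (hasDerivWithinAt_reflect hα hv) heq' hM' (hasDerivWithinAt_reflect hα hL) hL4' hD' hk ht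
  simp only [hneg, hnegs, sub_sub_cancel] at g1 g2
  have hexp : ‖s / (a : ℂ)‖ * (b - x) = ‖s‖ * ((b - x) / a) := by rw [hm]; ring
  rw [hexp] at g1 g2
  have hE := Real.exp_pos (‖s‖ * ((b - x) / a))
  have hEG := Real.exp_pos G
  have hs3 : ‖s‖ ^ 3 ≤ e ^ 3 * ‖s / (a : ℂ)‖ ^ 3 := by
    rw [← mul_pow, hm]
    refine pow_le_pow_left₀ hS.le ?_ 3
    rw [mul_div_assoc', le_div_iff₀ ha, mul_comm]
    exact mul_le_mul_of_nonneg_right hea hS.le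
  have hlift : ∀ z A : ℝ, 0 ≤ z → 0 ≤ A → z * ‖s / (a : ℂ)‖ ^ 3 ≤ ‖s / (a : ℂ)‖ ^ k * A →
      z * ‖s‖ ^ 3 ≤ e ^ 3 * (c ^ 3 * ‖s‖ ^ k * A) := by
    intro z A hz hA h
    calc z * ‖s‖ ^ 3 ≤ z * (e ^ 3 * ‖s / (a : ℂ)‖ ^ 3) := mul_le_mul_of_nonneg_left hs3 hz
      _ = e ^ 3 * (z * ‖s / (a : ℂ)‖ ^ 3) := by ring
      _ ≤ e ^ 3 * (c ^ 3 * ‖s‖ ^ k * A) := mul_le_mul_of_nonneg_left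
          (h.trans (mul_le_mul_of_nonneg_right (hpow k hk) hA)) (by positivity)
  constructor
  · refine (hlift _ _ (norm_nonneg _) (by positivity) g1).trans ?_
    have : Real.exp G ≤ 1 + (1 + G * e ^ 3) * Real.exp G := by
      have : 0 ≤ G * e ^ 3 * Real.exp G := by positivity
      linarith
    calc _ = 4 * (e ^ 3 * c ^ 3 * c ^ 3) * Real.exp G *
          (‖s‖ ^ k * M * Real.exp (‖s‖ * ((b - x) / a))) := by ring
      _ ≤ 4 * (e ^ 3 * c ^ 3 * c ^ 3) * (1 + (1 + G * e ^ 3) * Real.exp G) *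
          (‖s‖ ^ k * M * Real.exp (‖s‖ * ((b - x) / a))) := by gcongr
      _ = _ := by ring
  · refine (hlift _ _ (norm_nonneg _) (by positivity) g2).trans ?_
    have h1 : G * (4 * (c ^ 3 * M) * Real.exp G) / ‖s / (a : ℂ)‖ ^ 3 ≤
        4 * c ^ 3 * (G * e ^ 3 * Real.exp G) * (M / ‖s‖ ^ 3) := by
      have : (‖s / (a : ℂ)‖ ^ 3)⁻¹ ≤ e ^ 3 * (‖s‖ ^ 3)⁻¹ := by
        rw [inv_le_iff_one_le_mul₀ (by positivity), mul_right_comm, ← div_eq_mul_inv,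
          le_div_iff₀ (by positivity), one_mul]
        exact hs3
      calc _ = G * (4 * (c ^ 3 * M) * Real.exp G) * (‖s / (a : ℂ)‖ ^ 3)⁻¹ := div_eq_mul_inv _ _
        _ ≤ G * (4 * (c ^ 3 * M) * Real.exp G) * (e ^ 3 * (‖s‖ ^ 3)⁻¹) := by gcongr
        _ = _ := by rw [div_eq_mul_inv]; ring
    have h2 : 4 * (c ^ 3 * D) + G * (4 * (c ^ 3 * M) * Real.exp G) / ‖s / (a : ℂ)‖ ^ 3 ≤
        4 * c ^ 3 * (1 + (1 + G * e ^ 3) * Real.exp G) * (D + M / ‖s‖ ^ 3) := by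
      have e1 : 1 ≤ 1 + (1 + G * e ^ 3) * Real.exp G := by
        have : 0 ≤ (1 + G * e ^ 3) * Real.exp G := by positivity
        linarith
      have e2 : G * e ^ 3 * Real.exp G ≤ 1 + (1 + G * e ^ 3) * Real.exp G := by linarith
      calc _ ≤ 4 * c ^ 3 * 1 * D + 4 * c ^ 3 * (G * e ^ 3 * Real.exp G) * (M / ‖s‖ ^ 3) := by
            linarith
        _ ≤ 4 * c ^ 3 * (1 + (1 + G * e ^ 3) * Real.exp G) * D +
            4 * c ^ 3 * (1 + (1 + G * e ^ 3) * Real.exp G) * (M / ‖s‖ ^ 3) := by gcongr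
        _ = _ := by ring
    calc _ ≤ e ^ 3 * (c ^ 3 * ‖s‖ ^ k * (Real.exp (‖s‖ * ((b - x) / a)) *
          (4 * c ^ 3 * (1 + (1 + G * e ^ 3) * Real.exp G) * (D + M / ‖s‖ ^ 3)))) := by gcongr
      _ = _ := by ring

end Reflection

/-! ### The leading terms as solutions of the unperturbed equation -/

theorem iteratedDeriv_eq_of_hasDerivAt {f : ℕ → ℝ → ℂ}
    (hf : ∀ k x, HasDerivAt (f k) (f (k + 1) x) x) (k : ℕ) : iteratedDeriv k (f 0) = f k := by
  induction k with
  | zero => rw [iteratedDeriv_zero]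
  | succ k ih =>
    rw [iteratedDeriv_succ, ih]
    exact funext fun x => (hf k x).deriv

/-- The `k`-th derivative of `x ↦ A / 2 * (cosh (μ * (x - b)) - cos (μ * (x - b))) +
B / 2 * (sinh (μ * (x - b)) - sin (μ * (x - b)))`, as a sum of exponentials. -/
noncomputable def expLeading (A B μ : ℂ) (b : ℝ) (k : ℕ) (x : ℝ) : ℂ :=
  (A + B) / 4 * (μ ^ k * Complex.exp (μ * (x - b)))
    + (A - B) / 4 * ((-μ) ^ k * Complex.exp (-μ * (x - b)))
    + (-A + Complex.I * B) / 4 * ((Complex.I * μ) ^ k * Complex.exp (Complex.I * μ * (x - b)))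
    + (-A - Complex.I * B) / 4 *
      ((-(Complex.I * μ)) ^ k * Complex.exp (-(Complex.I * μ) * (x - b)))

theorem hasDerivAt_pow_mul_cexp (c : ℂ) (b : ℝ) (k : ℕ) (x : ℝ) :
    HasDerivAt (fun x : ℝ => c ^ k * Complex.exp (c * (x - b)))
      (c ^ (k + 1) * Complex.exp (c * (x - b))) x := by
  have h1 : HasDerivAt (fun x : ℝ => (x : ℂ)) ((1 : ℝ) : ℂ) x := (hasDerivAt_id x).ofReal_comp
  refine ((((h1.sub_const (b : ℂ)).const_mul c).cexp).const_mul (c ^ k)).congr_deriv ?_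
  push_cast
  ring

theorem hasDerivAt_expLeading (A B μ : ℂ) (b : ℝ) (k : ℕ) (x : ℝ) :
    HasDerivAt (expLeading A B μ b k) (expLeading A B μ b (k + 1) x) x :=
  ((((hasDerivAt_pow_mul_cexp μ b k x).const_mul _).add
    ((hasDerivAt_pow_mul_cexp (-μ) b k x).const_mul _)).add
    ((hasDerivAt_pow_mul_cexp (Complex.I * μ) b k x).const_mul _)).add
    ((hasDerivAt_pow_mul_cexp (-(Complex.I * μ)) b k x).const_mul _)

theorem expLeading_four (A B μ : ℂ) (b x : ℝ) :
    expLeading A B μ b 4 x = μ ^ 4 * expLeading A B μ b 0 x := by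
  have h1 : (Complex.I * μ) ^ 4 = μ ^ 4 := by rw [mul_pow, Complex.I_pow_four, one_mul]
  have h2 : ∀ z : ℂ, (-z) ^ 4 = z ^ 4 := fun z => by ring
  simp only [expLeading, h2, h1]
  ring

/-- The next four evaluations show that `A` and `B` prescribe the second and third derivatives at
`b` independently, the lower ones being zero. -/
theorem expLeading_zero_self (A B μ : ℂ) (b : ℝ) : expLeading A B μ b 0 b = 0 := by
  simp only [expLeading, sub_self, mul_zero, Complex.exp_zero]
  ring

theorem expLeading_one_self (A B μ : ℂ) (b : ℝ) : expLeading A B μ b 1 b = 0 := by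
  simp only [expLeading, sub_self, mul_zero, Complex.exp_zero]
  linear_combination B * μ / 2 * Complex.I_sq

theorem expLeading_two_self (A B μ : ℂ) (b : ℝ) : expLeading A B μ b 2 b = A * μ ^ 2 := by
  simp only [expLeading, sub_self, mul_zero, Complex.exp_zero]
  linear_combination -A * μ ^ 2 / 2 * Complex.I_sq

theorem expLeading_three_self (A B μ : ℂ) (b : ℝ) : expLeading A B μ b 3 b = B * μ ^ 3 := by
  simp only [expLeading, sub_self, mul_zero, Complex.exp_zero]
  linear_combination B * μ ^ 3 / 2 * (Complex.I ^ 2 - 1) * Complex.I_sq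

theorem leading_eq_expLeading (A B s : ℂ) (a b : ℝ) (k : ℕ) (x : ℝ) :
    -(A / 2) * iteratedDeriv k (fun y : ℝ => Complex.cos (s * (y - b) / a)) x
      - B / 2 * iteratedDeriv k (fun y : ℝ => Complex.sin (s * (y - b) / a)) x
      + A / 4 * iteratedDeriv k (fun y : ℝ =>
          Complex.exp (s * (y - b) / a) + Complex.exp (-(s * (y - b) / a))) x
      + B / 4 * iteratedDeriv k (fun y : ℝ =>
          Complex.exp (s * (y - b) / a) - Complex.exp (-(s * (y - b) / a))) x
    = expLeading A B (s / a) b k x := by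
  have hf : ∀ c : ℂ, ∀ n : WithTop ℕ∞, ContDiff ℝ n fun y : ℝ => Complex.exp (c * (y - b)) :=
    fun c n => (contDiff_const.mul (Complex.ofRealCLM.contDiff.sub contDiff_const)).cexp
  have he : ∀ c : ℂ, iteratedDeriv k (fun y : ℝ => Complex.exp (c * (y - b))) x =
      c ^ k * Complex.exp (c * (x - b)) := by
    intro c
    have := iteratedDeriv_eq_of_hasDerivAt (hasDerivAt_pow_mul_cexp c b) k
    simp only [pow_zero, one_mul] at this
    rw [this]
  have hcomb : ∀ p r c d : ℂ, iteratedDeriv k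
      (fun y : ℝ => p * Complex.exp (c * (y - b)) + r * Complex.exp (d * (y - b))) x =
      p * (c ^ k * Complex.exp (c * (x - b))) + r * (d ^ k * Complex.exp (d * (x - b))) := by
    intro p r c d
    rw [iteratedDeriv_fun_add (contDiff_const.mul (hf c k)).contDiffAt
      (contDiff_const.mul (hf d k)).contDiffAt, iteratedDeriv_const_mul_field,
      iteratedDeriv_const_mul_field, he, he]
  set μ : ℂ := s / a with hμ
  have h1 : (fun y : ℝ => Complex.cos (s * (y - b) / a)) = fun y : ℝ =>
      1 / 2 * Complex.exp (Complex.I * μ * (y - b)) +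
        1 / 2 * Complex.exp (-(Complex.I * μ) * (y - b)) := by
    funext y
    rw [Complex.cos, hμ]
    ring_nf
  have h2 : (fun y : ℝ => Complex.sin (s * (y - b) / a)) = fun y : ℝ =>
      -Complex.I / 2 * Complex.exp (Complex.I * μ * (y - b)) +
        Complex.I / 2 * Complex.exp (-(Complex.I * μ) * (y - b)) := by
    funext y
    rw [Complex.sin, hμ]
    ring_nf
  have h3 : (fun y : ℝ => Complex.exp (s * (y - b) / a) + Complex.exp (-(s * (y - b) / a))) =
      fun y : ℝ => 1 * Complex.exp (μ * (y - b)) + 1 * Complex.exp (-μ * (y - b)) := by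
    funext y
    rw [hμ]
    ring_nf
  have h4 : (fun y : ℝ => Complex.exp (s * (y - b) / a) - Complex.exp (-(s * (y - b) / a))) =
      fun y : ℝ => 1 * Complex.exp (μ * (y - b)) + (-1) * Complex.exp (-μ * (y - b)) := by
    funext y
    rw [hμ]
    ring_nf
  rw [h1, h2, h3, h4, hcomb, hcomb, hcomb, hcomb, expLeading]
  ring

theorem leftLeading_eq (a₁ δ₁ δ₂ : ℝ) (s v0 v1 : ℂ) (k : ℕ) (x : ℝ) :
    leftLeading a₁ δ₁ δ₂ s v0 v1 k x =
      expLeading ((a₁ : ℂ) ^ 2 * s ^ 2 * δ₁ * v1) ((a₁ : ℂ) ^ 3 * s * δ₂ * v0) (s / a₁) 0 k x := by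
  rw [← leading_eq_expLeading]
  simp only [leftLeading, Complex.ofReal_zero, sub_zero]

theorem chi12Leading_eq (a₂ : ℝ) (s : ℂ) (k : ℕ) (x : ℝ) :
    chi12Leading a₂ s k x = expLeading 0 ((a₂ : ℂ) ^ 3 * s) (s / a₂) 1 k x := by
  rw [← leading_eq_expLeading]
  simp only [chi12Leading, Complex.ofReal_one]
  ring

theorem chi22Leading_eq (a₂ : ℝ) (s : ℂ) (k : ℕ) (x : ℝ) :
    chi22Leading a₂ s k x = expLeading ((a₂ : ℂ) ^ 2 * s ^ 2) 0 (s / a₂) 1 k x := by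
  rw [← leading_eq_expLeading]
  simp only [chi22Leading, Complex.ofReal_one]
  ring

/-! ### Bounded potential, and solutions as chains -/

theorem exists_abs_le_of_continuousOn_of_tendsto {q : ℝ → ℝ}
    (hq : ContinuousOn q (Ico (-1) 0 ∪ Ioc 0 1))
    (hq_left : ∃ l : ℝ, Tendsto q (𝓝[<] 0) (𝓝 l))
    (hq_right : ∃ r : ℝ, Tendsto q (𝓝[>] 0) (𝓝 r)) :
    ∃ G : ℝ, 0 ≤ G ∧ ∀ x ∈ Ico (-1) 0 ∪ Ioc 0 1, |q x| ≤ G := by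
  obtain ⟨l, hl⟩ := hq_left
  obtain ⟨r, hr⟩ := hq_right
  have hl' : ∀ᶠ x in 𝓝[<] (0 : ℝ), |q x| < |l| + 1 :=
    hl.abs.eventually (gt_mem_nhds (lt_add_one _))
  have hr' : ∀ᶠ x in 𝓝[>] (0 : ℝ), |q x| < |r| + 1 :=
    hr.abs.eventually (gt_mem_nhds (lt_add_one _))
  obtain ⟨α, hα, hαl⟩ := mem_nhdsLT_iff_exists_Ioo_subset.mp hl'
  obtain ⟨β, hβ, hβr⟩ := mem_nhdsGT_iff_exists_Ioo_subset.mp hr'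
  have hα0 : α < 0 := hα
  have hβ0 : 0 < β := hβ
  obtain ⟨A, hA⟩ := isCompact_Icc.exists_bound_of_continuousOn
    (hq.mono (fun x (hx : x ∈ Icc (-1) α) => Or.inl ⟨hx.1, hx.2.trans_lt hα0⟩))
  obtain ⟨B, hB⟩ := isCompact_Icc.exists_bound_of_continuousOn
    (hq.mono (fun x (hx : x ∈ Icc β 1) => Or.inr ⟨hβ0.trans_le hx.1, hx.2⟩))
  refine ⟨(|l| + 1) + (|r| + 1) + |A| + |B|, by positivity, ?_⟩
  have h1 := abs_nonneg l
  have h2 := abs_nonneg r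
  have h3 := abs_nonneg A
  have h4 := abs_nonneg B
  rintro x (hx | hx)
  · rcases le_or_gt x α with h | h
    · have := (hA x ⟨hx.1, h⟩).trans (le_abs_self A)
      rw [Real.norm_eq_abs] at this
      linarith
    · have : |q x| < |l| + 1 := hαl ⟨h, hx.2⟩
      linarith
  · rcases le_or_gt β x with h | h
    · have := (hB x ⟨h, hx.2⟩).trans (le_abs_self B)
      rw [Real.norm_eq_abs] at this
      linarith
    · have : |q x| < |r| + 1 := hβr ⟨hx.1, h⟩
      linarith

section Chain

variable {α b : ℝ} {u : ℝ → ℂ}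

theorem hasDerivWithinAt_iteratedDerivWithin (hαb : α < b) (hu : ContDiffOn ℝ 4 u (Icc α b))
    (j : ℕ) (hj : j ≤ 3) (x : ℝ) (hx : x ∈ Icc α b) :
    HasDerivWithinAt (iteratedDerivWithin j u (Icc α b))
      (iteratedDerivWithin (j + 1) u (Icc α b) x) (Icc α b) x := by
  rw [iteratedDerivWithin_succ]
  refine (hu.differentiableOn_iteratedDerivWithin ?_ (uniqueDiffOn_Icc hαb) x hx).hasDerivWithinAt
  exact_mod_cast Nat.lt_succ_of_le hj

theorem iteratedDerivWithin_two_const_mul_two (c : ℂ) (u : ℝ → ℂ) (S : Set ℝ) (x : ℝ) :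
    iteratedDerivWithin 2 (fun y => c * iteratedDerivWithin 2 u S y) S x =
      c * iteratedDerivWithin 4 u S x := by
  rw [iteratedDerivWithin_const_mul_field, iteratedDerivWithin_succ (n := 3),
    iteratedDerivWithin_succ (n := 2), iteratedDerivWithin_succ (n := 1),
    iteratedDerivWithin_one]

/-- The equation is available only on `E`, away from `0`, where `q` has no prescribed value. As an
inequality with a uniform bound on `q` it no longer involves the values of `q`, and so passes to the
closure by continuity. -/
theorem norm_iteratedDerivWithin_four_sub_le (hαb : α < b) (hu : ContDiffOn ℝ 4 u (Icc α b))
    {q : ℝ → ℝ} {a G : ℝ} {s : ℂ} (ha : 0 < a) {E : Set ℝ} (hE : closure E = Icc α b)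
    (hq : ∀ x ∈ E, |q x| ≤ G)
    (heq : ∀ x ∈ E, iteratedDerivWithin 2
      (fun y => (a : ℂ) ^ 4 * iteratedDerivWithin 2 u (Icc α b) y) (Icc α b) x + (q x : ℂ) * u x =
        s ^ 4 * u x) (x : ℝ) (hx : x ∈ Icc α b) :
    ‖iteratedDerivWithin 4 u (Icc α b) x - (s / a) ^ 4 * iteratedDerivWithin 0 u (Icc α b) x‖ ≤
      G / a ^ 4 * ‖iteratedDerivWithin 0 u (Icc α b) x‖ := by
  have hud := uniqueDiffOn_Icc hαb
  have c4 : ContinuousOn (iteratedDerivWithin 4 u (Icc α b)) (Icc α b) :=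
    hu.continuousOn_iteratedDerivWithin le_rfl hud
  have c0 : ContinuousOn (iteratedDerivWithin 0 u (Icc α b)) (Icc α b) :=
    hu.continuousOn_iteratedDerivWithin (by norm_num) hud
  refine le_on_closure (s := E) (f := fun x => ‖iteratedDerivWithin 4 u (Icc α b) x -
    (s / a) ^ 4 * iteratedDerivWithin 0 u (Icc α b) x‖)
    (g := fun x => G / a ^ 4 * ‖iteratedDerivWithin 0 u (Icc α b) x‖) (fun x hx => ?_)
    (by rw [hE]; exact (c4.sub (continuousOn_const.mul c0)).norm)
    (by rw [hE]; exact continuousOn_const.mul c0.norm) (by rwa [hE])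
  have h := heq x hx
  rw [iteratedDerivWithin_two_const_mul_two] at h
  have ha' : (a : ℂ) ≠ 0 := Complex.ofReal_ne_zero.mpr ha.ne'
  have key : iteratedDerivWithin 4 u (Icc α b) x - (s / a) ^ 4 * u x =
      -((q x : ℂ) / (a : ℂ) ^ 4 * u x) := by
    field_simp
    linear_combination h
  simp only [iteratedDerivWithin_zero]
  rw [key, norm_neg, norm_mul, norm_div, norm_pow, Complex.norm_real, Complex.norm_real,
    Real.norm_of_nonneg ha.le, Real.norm_eq_abs]
  have := hq x hx
  gcongr

end Chain

theorem IsRightSolution.hasDerivWithinAt {a₂ : ℝ} {q : ℝ → ℝ} {lam : ℂ} {u : ℝ → ℂ}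
    (h : IsRightSolution a₂ q lam u) : ∀ j ≤ 3, ∀ x ∈ Icc (0 : ℝ) 1,
      HasDerivWithinAt (dRight j u) (dRight (j + 1) u x) (Icc 0 1) x :=
  hasDerivWithinAt_iteratedDerivWithin zero_lt_one h.contDiffOn

theorem IsLeftSolution.hasDerivWithinAt {a₁ : ℝ} {q : ℝ → ℝ} {lam : ℂ} {u : ℝ → ℂ}
    (h : IsLeftSolution a₁ q lam u) : ∀ j ≤ 3, ∀ x ∈ Icc (-1 : ℝ) 0,
      HasDerivWithinAt (dLeft j u) (dLeft (j + 1) u x) (Icc (-1) 0) x :=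
  hasDerivWithinAt_iteratedDerivWithin (by norm_num) h.contDiffOn

/-! ### Estimates on the two intervals -/

theorem exists_right_estimate (a₂ : ℝ) (ha₂ : 0 < a₂) {q : ℝ → ℝ} {G : ℝ} (hG : 0 ≤ G)
    (hq : ∀ x ∈ Ioc (0 : ℝ) 1, |q x| ≤ G) :
    ∃ C : ℝ, 0 ≤ C ∧ ∀ s : ℂ, 1 ≤ ‖s‖ → a₂ ≤ ‖s‖ → ∀ (v : ℝ → ℂ) (c : Fin 4 → ℂ) (A B : ℂ) (p : ℕ),
      p ≤ 7 → IsRightCauchySolution a₂ q (s ^ 4) c v →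
      (∀ j : Fin 4, ‖c j‖ * ‖s‖ ^ (3 - (j : ℕ)) ≤ ‖s‖ ^ p) →
      (∀ j : Fin 4, ‖c j - expLeading A B (s / a₂) 1 j 1‖ * ‖s‖ ^ (3 - (j : ℕ)) ≤ ‖s‖ ^ 4) →
      ∀ k ≤ 3,
        ‖dRight k v 0‖ * ‖s‖ ^ 3 ≤
          ‖s‖ ^ k * (C * ‖s‖ ^ p * Real.exp (‖s‖ * (1 / a₂))) ∧
        ∀ x ∈ Icc (0 : ℝ) 1, ‖dRight k v x - expLeading A B (s / a₂) 1 k x‖ ≤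
          2 * C * (‖s‖ ^ (k + 1) * Real.exp (‖s‖ * ((1 - x) / a₂))) := by
  obtain ⟨C, hC, h⟩ := exists_chain_estimate (α := 0) (b := 1) a₂ (G / a₂ ^ 4) ha₂
    (by positivity) (zero_add 1)
  refine ⟨C, hC, fun s hs1 hsa v c A B p hp hv hM hD k hk => ?_⟩
  have hS : 0 < ‖s‖ := by linarith
  have hv1 : ∀ j : ℕ, ∀ hj : j ≤ 3, dRight j v 1 = c ⟨j, by omega⟩ := fun j hj =>
    hv.initial ⟨j, by omega⟩
  have h' := h s hs1 hsa (fun j => dRight j v) (expLeading A B (s / a₂) 1) (‖s‖ ^ p) (‖s‖ ^ 4)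
    hv.solution.hasDerivWithinAt
    (norm_iteratedDerivWithin_four_sub_le zero_lt_one hv.solution.contDiffOn ha₂
      (closure_Ioc zero_ne_one) hq hv.solution.equation)
    (fun j _ x _ => (hasDerivAt_expLeading A B _ 1 j x).hasDerivWithinAt)
    (fun x _ => expLeading_four A B _ 1 x)
    (fun j hj => by rw [hv1 j hj]; exact hM ⟨j, by omega⟩)
    (fun j hj => by rw [hv1 j hj]; exact hD ⟨j, by omega⟩) k hk
  constructor
  · have := (h' 0 (left_mem_Icc.mpr zero_le_one)).1
    rw [sub_zero] at this
    linarith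
  · intro x hx
    have h2 := (h' x hx).2
    -- For `p ≤ 7` the potential costs no more than the allowed discrepancy `‖s‖ ^ 4` of the data;
    -- division by `‖s‖ ^ 3` then leaves `‖s‖ ^ (k + 1)`.
    have hdiv : ‖s‖ ^ p / ‖s‖ ^ 3 ≤ ‖s‖ ^ 4 := by
      rw [div_le_iff₀ (by positivity), ← pow_add]
      exact pow_le_pow_right₀ hs1 hp
    refine le_of_mul_le_mul_right (h2.trans ?_) (pow_pos hS 3)
    calc _ ≤ C * ‖s‖ ^ k * (‖s‖ ^ 4 + ‖s‖ ^ 4) * Real.exp (‖s‖ * ((1 - x) / a₂)) := by gcongr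
      _ = _ := by ring

theorem exists_left_estimate (a₁ δ₁ δ₂ : ℝ) (ha₁ : 0 < a₁) {q : ℝ → ℝ} {G : ℝ} (hG : 0 ≤ G)
    (hq : ∀ x ∈ Ico (-1 : ℝ) 0, |q x| ≤ G) :
    ∃ C : ℝ, 0 ≤ C ∧ ∀ s : ℂ, 1 ≤ ‖s‖ → a₁ ≤ ‖s‖ → ∀ (u v : ℝ → ℂ) (N : ℝ),
      IsLeftTransmitted a₁ δ₁ δ₂ q (s ^ 4) u v →
      (∀ k ≤ 3, ‖dRight k v 0‖ * ‖s‖ ^ 3 ≤ ‖s‖ ^ k * N) →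
      ∀ k ≤ 3, ∀ x ∈ Icc (-1 : ℝ) 0,
        ‖dLeft k u x - leftLeading a₁ δ₁ δ₂ s (dRight 0 v 0) (dRight 1 v 0) k x‖ * ‖s‖ ^ 3 ≤
          C * ‖s‖ ^ k * N * Real.exp (‖s‖ * ((0 - x) / a₁)) := by
  obtain ⟨C, hC, h⟩ := exists_chain_estimate (α := -1) (b := 0) a₁ (G / a₁ ^ 4) ha₁
    (by positivity) (by norm_num)
  refine ⟨C * (2 + |δ₁| + |δ₂|), by positivity, fun s hs1 hsa u v N hu hv k hk x hx => ?_⟩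
  have hS : 0 < ‖s‖ := by linarith
  have hN : 0 ≤ N := by
    have := hv 0 (by norm_num)
    rw [pow_zero, one_mul] at this
    exact le_trans (by positivity) this
  have ha' : (a₁ : ℂ) ≠ 0 := Complex.ofReal_ne_zero.mpr ha₁.ne'
  set v0 := dRight 0 v 0 with hv0
  set v1 := dRight 1 v 0 with hv1
  set v2 := dRight 2 v 0 with hv2
  set v3 := dRight 3 v 0 with hv3
  have n0 : ‖v0‖ * ‖s‖ ^ 3 ≤ N := by simpa using hv 0 (by norm_num)
  have n1 : ‖v1‖ * ‖s‖ ^ 2 ≤ N :=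
    le_of_mul_le_mul_right (by linarith [hv 1 (by norm_num)]) hS
  have n2 : ‖v2‖ * ‖s‖ ≤ N :=
    le_of_mul_le_mul_right (by linarith [hv 2 (by norm_num)]) (pow_pos hS 2)
  have n3 : ‖v3‖ ≤ N :=
    le_of_mul_le_mul_right (by linarith [hv 3 (by norm_num)]) (pow_pos hS 3)
  have hS3 : 1 ≤ ‖s‖ ^ 3 := one_le_pow₀ hs1
  have hd1 := abs_nonneg δ₁
  have hd2 := abs_nonneg δ₂
  have hNS : N ≤ N * ‖s‖ ^ 3 := le_mul_of_one_le_right hN hS3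
  have hle : N ≤ (1 + |δ₁| + |δ₂|) * N * ‖s‖ ^ 3 := by
    have : 0 ≤ (|δ₁| + |δ₂|) * (N * ‖s‖ ^ 3) := by positivity
    linarith
  -- The factor `‖s‖ ^ 3` comes from the jump in the second derivative: `‖s‖ ^ 4 * ‖v1‖ * ‖s‖ ≤ ‖s‖
  -- ^ 3 * N`.
  have hM : ∀ j ≤ 3, ‖dLeft j u 0‖ * ‖s‖ ^ (3 - j) ≤ (1 + |δ₁| + |δ₂|) * N * ‖s‖ ^ 3 := by
    intro j hj
    interval_cases j
    · rw [hu.trans_zero]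
      exact n0.trans hle
    · rw [hu.trans_one]
      exact n1.trans hle
    · rw [hu.trans_two]
      have ht : ‖v2 + s ^ 4 * δ₁ * v1‖ ≤ ‖v2‖ + ‖s‖ ^ 4 * |δ₁| * ‖v1‖ := by
        refine (norm_add_le _ _).trans_eq ?_
        rw [norm_mul, norm_mul, norm_pow, Complex.norm_real, Real.norm_eq_abs]
      have hb := mul_le_mul_of_nonneg_right ht hS.le
      have hc := mul_le_mul_of_nonneg_left n1 (by positivity : 0 ≤ |δ₁| * ‖s‖ ^ 3)
      have hd : 0 ≤ |δ₂| * (N * ‖s‖ ^ 3) := by positivity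
      norm_num
      linarith
    · rw [hu.trans_three]
      have ht : ‖v3 + s ^ 4 * δ₂ * v0‖ ≤ ‖v3‖ + ‖s‖ ^ 4 * |δ₂| * ‖v0‖ := by
        refine (norm_add_le _ _).trans_eq ?_
        rw [norm_mul, norm_mul, norm_pow, Complex.norm_real, Real.norm_eq_abs]
      have hc := mul_le_mul_of_nonneg_left n0 (by positivity : 0 ≤ |δ₂| * ‖s‖)
      have he : |δ₂| * ‖s‖ * N ≤ |δ₂| * ‖s‖ ^ 3 * N := by
        have : ‖s‖ ≤ ‖s‖ ^ 3 := le_self_pow₀ hs1 (by norm_num)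
        gcongr
      have hd : 0 ≤ |δ₁| * (N * ‖s‖ ^ 3) := by positivity
      norm_num
      linarith
  -- The leading term reproduces both jumps exactly, so the discrepancy in the data is just `v` and
  -- its derivatives at `0`, with no factor `‖s‖ ^ 3`.
  have hD : ∀ j ≤ 3, ‖dLeft j u 0 - expLeading ((a₁ : ℂ) ^ 2 * s ^ 2 * δ₁ * v1)
      ((a₁ : ℂ) ^ 3 * s * δ₂ * v0) (s / a₁) 0 j 0‖ * ‖s‖ ^ (3 - j) ≤ N := by
    intro j hj
    interval_cases j
    · rw [expLeading_zero_self, sub_zero, hu.trans_zero]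
      exact n0
    · rw [expLeading_one_self, sub_zero, hu.trans_one]
      exact n1
    · rw [expLeading_two_self, hu.trans_two]
      have : v2 + s ^ 4 * δ₁ * v1 - (a₁ : ℂ) ^ 2 * s ^ 2 * δ₁ * v1 * (s / a₁) ^ 2 = v2 := by
        field_simp
        ring
      rw [this]
      simpa using n2
    · rw [expLeading_three_self, hu.trans_three]
      have : v3 + s ^ 4 * δ₂ * v0 - (a₁ : ℂ) ^ 3 * s * δ₂ * v0 * (s / a₁) ^ 3 = v3 := by
        field_simp
        ring
      rw [this]
      simpa using n3
  have h' := (h s hs1 hsa (fun j => dLeft j u) (expLeading _ _ (s / a₁) 0) _ N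
    hu.solution.hasDerivWithinAt
    (norm_iteratedDerivWithin_four_sub_le (by norm_num) hu.solution.contDiffOn ha₁
      (closure_Ico (by norm_num)) hq hu.solution.equation)
    (fun j _ x _ => (hasDerivAt_expLeading _ _ _ 0 j x).hasDerivWithinAt)
    (fun x _ => expLeading_four _ _ _ 0 x) hM hD k hk x hx).2
  rw [leftLeading_eq]
  refine h'.trans_eq ?_
  rw [mul_div_cancel_right₀ _ (pow_pos hS 3).ne']
  ring

/-! ### The asymptotic formulas -/

theorem lemma4p3 (a₁ a₂ : ℝ) (ha₁ : 0 < a₁) (ha₂ : 0 < a₂) (δ₁ δ₂ : ℝ)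
    (q : ℝ → ℝ) (hq : ContinuousOn q (Ico (-1) 0 ∪ Ioc 0 1))
    (hq_left : ∃ l : ℝ, Tendsto q (𝓝[<] 0) (𝓝 l))
    (hq_right : ∃ r : ℝ, Tendsto q (𝓝[>] 0) (𝓝 r)) :
    ∃ C R : ℝ, 0 < R ∧ ∀ s : ℂ, R ≤ ‖s‖ →
      ∀ χ₁₁ χ₁₂ χ₂₁ χ₂₂ : ℝ → ℂ,
        IsChiOne a₁ a₂ δ₁ δ₂ q (s ^ 4) χ₁₁ χ₁₂ →
        IsChiTwo a₁ a₂ δ₁ δ₂ q (s ^ 4) χ₂₁ χ₂₂ →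
        ∀ k : ℕ, k ≤ 3 →
          (∀ x ∈ Icc (-1 : ℝ) 0,
            ‖dLeft k χ₁₁ x - leftLeading a₁ δ₁ δ₂ s (dRight 0 χ₁₂ 0) (dRight 1 χ₁₂ 0) k x‖
              ≤ C * (‖s‖ ^ (k + 1) * Real.exp (‖s‖ * ((a₁ - a₂ * x) / (a₁ * a₂))))) ∧
          (∀ x ∈ Icc (0 : ℝ) 1,
            ‖dRight k χ₁₂ x - chi12Leading a₂ s k x‖
              ≤ C * (‖s‖ ^ (k + 1) * Real.exp (‖s‖ * ((1 - x) / a₂)))) ∧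
          (∀ x ∈ Icc (-1 : ℝ) 0,
            ‖dLeft k χ₂₁ x - leftLeading a₁ δ₁ δ₂ s (dRight 0 χ₂₂ 0) (dRight 1 χ₂₂ 0) k x‖
              ≤ C * (‖s‖ ^ (k + 2) * Real.exp (‖s‖ * ((a₁ - a₂ * x) / (a₁ * a₂))))) ∧
          (∀ x ∈ Icc (0 : ℝ) 1,
            ‖dRight k χ₂₂ x - chi22Leading a₂ s k x‖
              ≤ C * (‖s‖ ^ (k + 1) * Real.exp (‖s‖ * ((1 - x) / a₂)))) := by
  obtain ⟨G, hG, hqG⟩ := exists_abs_le_of_continuousOn_of_tendsto hq hq_left hq_right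
  obtain ⟨Cr, hCr, hr⟩ := exists_right_estimate a₂ ha₂ hG fun x hx => hqG x (Or.inr hx)
  obtain ⟨Cl, hCl, hl⟩ := exists_left_estimate a₁ δ₁ δ₂ ha₁ hG fun x hx => hqG x (Or.inl hx)
  refine ⟨2 * Cr + Cl * Cr, 1 + a₁ + a₂, by positivity, ?_⟩
  intro s hs χ₁₁ χ₁₂ χ₂₁ χ₂₂ h1 h2 k hk
  have hs1 : 1 ≤ ‖s‖ := by linarith
  have hs₁ : a₁ ≤ ‖s‖ := by linarith
  have hs₂ : a₂ ≤ ‖s‖ := by linarith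
  have hS : 0 < ‖s‖ := by linarith
  have ha' : (a₂ : ℂ) ≠ 0 := Complex.ofReal_ne_zero.mpr ha₂.ne'
  have hpow : ∀ {i j : ℕ}, i ≤ j → ‖s‖ ^ i ≤ ‖s‖ ^ j := fun h => pow_le_pow_right₀ hs1 h
  have hp3 : (a₂ : ℂ) ^ 3 * s * (s / a₂) ^ 3 = s ^ 4 := by field_simp
  have hp2 : (a₂ : ℂ) ^ 2 * s ^ 2 * (s / a₂) ^ 2 = s ^ 4 := by field_simp
  -- The weighted data have size `‖s‖ ^ 4`, from the third derivative `s ^ 4`. The leading term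
  -- removes it and leaves only the value `-1`, of weight `‖s‖ ^ 3`.
  have r1 := hr s hs1 hs₂ χ₁₂ _ 0 ((a₂ : ℂ) ^ 3 * s) 4 (by norm_num) h1.right
    (by
      intro j
      fin_cases j
      · simpa using hpow (show 3 ≤ 4 by norm_num)
      · simp
      · simp
      · simp)
    (by
      intro j
      fin_cases j
      · simpa [expLeading_zero_self] using hpow (show 3 ≤ 4 by norm_num)
      · simp [expLeading_one_self]
      · simp [expLeading_two_self]
      · simp [expLeading_three_self, hp3])
  -- Now `s ^ 4` is the second derivative, of weight `‖s‖`, hence the exponent `5`. This extra power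
  -- is why the error for `χ₂₁` has `k + 2` instead of `k + 1`.
  have r2 := hr s hs1 hs₂ χ₂₂ _ ((a₂ : ℂ) ^ 2 * s ^ 2) 0 5 (by norm_num) h2.right
    (by
      intro j
      fin_cases j
      · simp
      · simpa using hpow (show 2 ≤ 5 by norm_num)
      · simp [← pow_succ]
      · simp)
    (by
      intro j
      fin_cases j
      · simp [expLeading_zero_self]
      · simpa [expLeading_one_self] using hpow (show 2 ≤ 4 by norm_num)
      · simp [expLeading_two_self, hp2]
      · simp [expLeading_three_self])
  have hright : ∀ {z E : ℝ}, 0 ≤ E → z ≤ 2 * Cr * E → z ≤ (2 * Cr + Cl * Cr) * E := by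
    intro z E hE hz
    have : 0 ≤ Cl * Cr * E := by positivity
    linarith
  have hexp : ∀ x : ℝ, Real.exp (‖s‖ * (1 / a₂)) * Real.exp (‖s‖ * ((0 - x) / a₁)) =
      Real.exp (‖s‖ * ((a₁ - a₂ * x) / (a₁ * a₂))) := by
    intro x
    rw [← Real.exp_add]
    congr 1
    field_simp
    ring
  -- Data of size `‖s‖ ^ (p + 3)` at `1` give an error of order `‖s‖ ^ (k + p)` on the left: `p = 1`
  -- for `χ₁₁` and `p = 2` for `χ₂₁`. The growth across `[0, 1]` and then from `0` to `x` multiply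
  -- to the stated exponential.
  have hleft : ∀ {z x : ℝ} (p : ℕ),
      z * ‖s‖ ^ 3 ≤ Cl * ‖s‖ ^ k * (Cr * ‖s‖ ^ (p + 3) * Real.exp (‖s‖ * (1 / a₂))) *
        Real.exp (‖s‖ * ((0 - x) / a₁)) →
      z ≤ (2 * Cr + Cl * Cr) *
        (‖s‖ ^ (k + p) * Real.exp (‖s‖ * ((a₁ - a₂ * x) / (a₁ * a₂)))) := by
    intro z x p hz
    have hE : 0 ≤ ‖s‖ ^ (k + p) * Real.exp (‖s‖ * ((a₁ - a₂ * x) / (a₁ * a₂))) := by positivity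
    have : z ≤ Cl * Cr * (‖s‖ ^ (k + p) * Real.exp (‖s‖ * ((a₁ - a₂ * x) / (a₁ * a₂)))) := by
      refine le_of_mul_le_mul_right (hz.trans_eq ?_) (pow_pos hS 3)
      rw [← hexp]
      ring
    have : 0 ≤ 2 * Cr * (‖s‖ ^ (k + p) * Real.exp (‖s‖ * ((a₁ - a₂ * x) / (a₁ * a₂)))) := by
      positivity
    linarith
  refine ⟨fun x hx => hleft 1 ?_, fun x hx => hright (by positivity) ?_,
    fun x hx => hleft 2 ?_, fun x hx => hright (by positivity) ?_⟩
  · exact hl s hs1 hs₁ χ₁₁ χ₁₂ _ h1.left (fun j hj => (r1 j hj).1) k hk x hx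
  · rw [chi12Leading_eq]
    exact (r1 k hk).2 x hx
  · exact hl s hs1 hs₁ χ₂₁ χ₂₂ _ h2.left (fun j hj => (r2 j hj).1) k hk x hx
  · rw [chi22Leading_eq]
    exact (r2 k hk).2 x hx
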